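/- For a positive integer $n$, let $p(n)$ denote the number of partitions of $n$. The (Andrews–Garvan–Dyson) crank of a partition is its largest part if the partition contains no ones, and otherwise it is the number of parts larger than the number of ones, minus the number of ones. For $n>1$ let $M(m,n)$ denote the number of partitions of $n$ with crank $m$. Then for every integer $n\ge 39$, $$p(n)\;\ge\;21\,M(0,n).$$ -/

import Mathlib

namespace PartitionCrank

/-- The Andrews–Garvan–Dyson crank of a partition `π` with `ω` ones: the largest part of `π` if
`ω = 0`, and otherwise the number of parts of `π` larger than `ω`, minus `ω`.
(The supremum of the multiset of parts is the largest part; it is `0` for the empty partition.) -/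
def crank {n : ℕ} (π : n.Partition) : ℤ :=
  if π.parts.count 1 = 0 then (π.parts.sup : ℤ)
  else ((π.parts.filter (fun i => π.parts.count 1 < i)).card : ℤ) - (π.parts.count 1 : ℤ)

/-- `M m n` is the number of partitions of `n` with crank `m`, except that for `n = 1` one sets
`M(0,1) = -1`, `M(1,1) = M(-1,1) = 1` and `M(m,1) = 0` for all other `m`. -/
def M (m : ℤ) (n : ℕ) : ℤ :=
  if n = 1 then
    if m = 0 then -1 else if m = 1 ∨ m = -1 then 1 else 0
  else (Fintype.card {π : n.Partition // crank π = m} : ℤ)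

end PartitionCrank

open PowerSeries

namespace PartitionCrank

/-! A partition with crank `0` and `k + 1` ones has exactly `k + 1` parts exceeding `k + 1`, the
rest lying in `[2, k + 1]`. It is thus counted by `q^((k+1)(k+3)) C_k`, with `C_k = 1 / ((1 - q)
∏_{j=2}^{k+1} (1 - q^j)^2)`. A partition with `k + 1` parts at least `k + 2` and the others at most
`k + 2` (a Durfee rectangle) is counted by `q^((k+1)(k+2)) C_k / ((1 - q)(1 - q^(k+2)))`. Different
`k` give disjoint families, so their sum bounds `p(n)` from below, and it suffices to compare the
two sums.

For large `n` the comparison holds term by term. The factor `1 / (1 - q)` turns coefficients into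
partial sums, and `C_k`, a product of `2k + 1` geometric series, satisfies `m c_m ≤ (2k + 1) ∑_{i<m}
c_i` (`hasGrowth_crankGF`). This gives the factor `21` once `n ≥ 436`
(`mul_coeff_X_pow_mul_crankGF_le`). For `39 ≤ n < 440` the sums are computed in the kernel, each
series packed into one large integer by Kronecker substitution (`crankTotal_le_rectTotal`). -/

/-- The geometric series `1 + X ^ d + X ^ (2 d) + ⋯`. -/
noncomputable def geom (d : ℕ) : ℕ⟦X⟧ := PowerSeries.mk fun n => if d ∣ n then 1 else 0

lemma geom_eq {d : ℕ} (hd : 0 < d) : geom d = 1 + X ^ d * geom d := by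
  ext n
  rw [map_add, coeff_X_pow_mul', coeff_one, geom, coeff_mk]
  rcases Nat.eq_zero_or_pos n with rfl | hn
  · simp [hd.ne']
  · by_cases hdn : d ≤ n
    · have h : d ∣ n - d ↔ d ∣ n := by
        rw [← Nat.dvd_add_left (dvd_refl d), Nat.sub_add_cancel hdn]
      simp [hn.ne', hdn, h]
    · have h : ¬ d ∣ n := fun h => hdn (Nat.le_of_dvd hn h)
      simp [hn.ne', hdn, h]

lemma geom_mul {d : ℕ} (hd : 0 < d) (G : ℕ⟦X⟧) :
    geom d * G = G + X ^ d * (geom d * G) := by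
  conv_lhs => rw [geom_eq hd]
  ring

lemma coeff_geom_mul {d : ℕ} (hd : 0 < d) (G : ℕ⟦X⟧) (n : ℕ) :
    coeff n (geom d * G) = coeff n G + if d ≤ n then coeff (n - d) (geom d * G) else 0 := by
  conv_lhs => rw [geom_mul hd]
  rw [map_add, coeff_X_pow_mul']

lemma coeff_geom_mul_of_lt {d : ℕ} (hd : 0 < d) (G : ℕ⟦X⟧) {n : ℕ} (hn : n < d) :
    coeff n (geom d * G) = coeff n G := by
  rw [coeff_geom_mul hd, if_neg (by omega), add_zero]

lemma coeff_geom_mul_add {d : ℕ} (hd : 0 < d) (G : ℕ⟦X⟧) (n : ℕ) :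
    coeff (n + d) (geom d * G) = coeff (n + d) G + coeff n (geom d * G) := by
  rw [coeff_geom_mul hd, if_pos (by omega), Nat.add_sub_cancel]

lemma coeff_le_coeff_geom_mul {d : ℕ} (hd : 0 < d) (G : ℕ⟦X⟧) (n : ℕ) :
    coeff n G ≤ coeff n (geom d * G) := by
  rw [coeff_geom_mul hd]
  exact Nat.le_add_right _ _

lemma coeff_geom_one_mul (G : ℕ⟦X⟧) (n : ℕ) :
    coeff n (geom 1 * G) = ∑ i ∈ Finset.range (n + 1), coeff i G := by
  induction n with
  | zero => simp [coeff_geom_mul_of_lt one_pos G one_pos]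
  | succ n ih => rw [coeff_geom_mul_add one_pos, ih, Finset.sum_range_succ _ (n + 1), add_comm]

/-- An induction principle for the coefficients of `geom d * G`. -/
lemma add_period_induction {d : ℕ} {P : ℕ → Prop} (base : ∀ n < d, P n)
    (step : ∀ n, P n → P (n + d)) (hd : 0 < d) (n : ℕ) : P n := by
  induction n using Nat.strong_induction_on with
  | _ n ih =>
    rcases lt_or_ge n d with h | h
    · exact base n h
    · obtain ⟨m, rfl⟩ := Nat.exists_eq_add_of_le' h
      exact step m (ih m (by omega))

lemma monotone_coeff_geom_mul {d : ℕ} (hd : 0 < d) {G : ℕ⟦X⟧}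
    (hG : Monotone fun n => coeff n G) : Monotone fun n => coeff n (geom d * G) := by
  refine monotone_nat_of_le_succ fun n => ?_
  induction n using add_period_induction (d := d) (hd := hd) with
  | base n hn =>
    rw [coeff_geom_mul_of_lt hd G hn]
    exact (hG n.le_succ).trans (coeff_le_coeff_geom_mul hd G _)
  | step n ih =>
    rw [coeff_geom_mul_add hd, show n + d + 1 = n + 1 + d by ring, coeff_geom_mul_add hd]
    exact Nat.add_le_add (hG (by omega)) ih

/-! ### Growth of coefficients against partial sums -/

/-- The sum of the coefficients of `G` of index less than `n`. -/
noncomputable def partialSum (G : ℕ⟦X⟧) (n : ℕ) : ℕ := ∑ i ∈ Finset.range n, coeff i G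

lemma partialSum_add_ge {G : ℕ⟦X⟧} (hG : Monotone fun n => coeff n G) (m d : ℕ) :
    partialSum G m + d * coeff m G ≤ partialSum G (m + d) := by
  rw [partialSum, partialSum, Finset.sum_range_add]
  refine Nat.add_le_add_left ?_ _
  have h := Finset.card_nsmul_le_sum (Finset.range d) (fun i => coeff (m + i) G) (coeff m G)
    (fun i _ => hG (Nat.le_add_right m i))
  simpa using h

lemma partialSum_geom_mul_add {d : ℕ} (hd : 0 < d) (G : ℕ⟦X⟧) (m : ℕ) :
    partialSum (geom d * G) (m + d) = partialSum G (m + d) + partialSum (geom d * G) m := by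
  rw [partialSum, add_comm m d, Finset.sum_range_add, partialSum, partialSum,
    Finset.sum_range_add, add_assoc, ← Finset.sum_add_distrib]
  congr 1
  · exact Finset.sum_congr rfl fun i hi =>
      coeff_geom_mul_of_lt hd G (Finset.mem_range.1 hi)
  · refine Finset.sum_congr rfl fun i _ => ?_
    rw [add_comm d i, coeff_geom_mul_add hd]

/-- The coefficients of `G` grow at most like those of `(1 - X) ^ (-C)`. -/
def HasGrowth (C : ℕ) (G : ℕ⟦X⟧) : Prop := ∀ m, m * coeff m G ≤ C * partialSum G m

/-- The left side sums `G` along indices congruent to `m` modulo `d`; by monotonicity each term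
below `m`, taken `d` times, is at most the sum of the block of `d` coefficients starting there. -/
lemma mul_coeff_geom_mul_le {d : ℕ} (hd : 0 < d) {G : ℕ⟦X⟧}
    (hG : Monotone fun n => coeff n G) (m : ℕ) :
    d * coeff m (geom d * G) ≤ partialSum G m + d * coeff m G := by
  induction m using add_period_induction (d := d) (hd := hd) with
  | base n hn =>
    rw [coeff_geom_mul_of_lt hd G hn]
    omega
  | step n ih =>
    rw [coeff_geom_mul_add hd, mul_add]
    have := partialSum_add_ge hG n d
    omega

/-- A discrete form of differentiating `G / (1 - q^d)`: the weight `m` falls either on `G`, where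
the growth bound applies, or on the geometric factor, which yields a second copy of it. -/
lemma add_mul_coeff_geom_mul_le {d C : ℕ} (hd : 0 < d) {G : ℕ⟦X⟧} (hC : HasGrowth C G) (m : ℕ) :
    (m + d) * coeff m (geom d * G) ≤
      C * partialSum (geom d * G) m + d * coeff m (geom d * (geom d * G)) := by
  induction m using add_period_induction (d := d) (hd := hd) with
  | base n hn =>
    rw [coeff_geom_mul_of_lt hd _ hn, coeff_geom_mul_of_lt hd _ hn, coeff_geom_mul_of_lt hd _ hn,
      add_mul]
    refine Nat.add_le_add_right ((hC n).trans (Nat.mul_le_mul_left _ ?_)) _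
    exact Finset.sum_le_sum fun i _ => coeff_le_coeff_geom_mul hd G i
  | step n ih =>
    have h := hC (n + d)
    rw [partialSum_geom_mul_add hd, coeff_geom_mul_add hd (geom d * G),
      coeff_geom_mul_add hd G]
    nlinarith

/-- The doubled geometric factor left by the derivative bound costs one more partial sum plus a term
`d * coeff m (geom d * G)`, which cancels. Each geometric factor therefore raises the constant by
one. -/
lemma HasGrowth.geom_mul {d C : ℕ} (hd : 0 < d) {G : ℕ⟦X⟧} (hG : Monotone fun n => coeff n G)
    (hC : HasGrowth C G) : HasGrowth (C + 1) (geom d * G) := by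
  intro m
  have h1 := add_mul_coeff_geom_mul_le hd hC m
  have h2 := mul_coeff_geom_mul_le hd (monotone_coeff_geom_mul hd hG) m
  rw [add_mul] at h1 ⊢
  omega

/-! ### The two generating functions and the termwise comparison -/

/-- The generating function, up to a power of `X`, of the partitions with crank `0` and exactly
`k + 1` ones. -/
noncomputable def crankGF : ℕ → ℕ⟦X⟧
  | 0 => geom 1
  | k + 1 => geom (k + 2) * (geom (k + 2) * crankGF k)

/-- The generating function, up to a power of `X`, of the partitions with `k + 1` parts that are
at least `k + 2` and all other parts at most `k + 2`. -/
noncomputable def rectGF (k : ℕ) : ℕ⟦X⟧ := geom (k + 2) * (geom 1 * crankGF k)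

lemma monotone_coeff_crankGF (k : ℕ) : Monotone fun n => coeff n (crankGF k) := by
  induction k with
  | zero => simp [crankGF, geom, Monotone]
  | succ k ih =>
    exact monotone_coeff_geom_mul (by omega) (monotone_coeff_geom_mul (by omega) ih)

lemma hasGrowth_crankGF (k : ℕ) : HasGrowth (2 * k + 1) (crankGF k) := by
  induction k with
  | zero => intro m; simp [crankGF, geom, partialSum]
  | succ k ih =>
    exact (ih.geom_mul (by omega) (monotone_coeff_crankGF k)).geom_mul (by omega)
      (monotone_coeff_geom_mul (by omega) (monotone_coeff_crankGF k))

/-- After dropping `geom (k + 2)`, the right side is a sum of coefficients up to index `m + k + 1`.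
Those below `m` contribute at least `19 - k` copies of the `m`-th by growth, and the last `k + 2`
contribute `k + 2` copies by monotonicity. -/
lemma mul_coeff_crankGF_le_coeff_rectGF {k m : ℕ} (h : (19 - k) * (2 * k + 1) ≤ m) :
    21 * coeff m (crankGF k) ≤ coeff (m + (k + 1)) (rectGF k) := by
  refine le_trans ?_ (coeff_le_coeff_geom_mul (by omega) _ _)
  rw [coeff_geom_one_mul]
  refine le_trans ?_ (partialSum_add_ge (monotone_coeff_crankGF k) m (k + 2))
  have h1 : (19 - k) * coeff m (crankGF k) ≤ partialSum (crankGF k) m := by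
    refine Nat.le_of_mul_le_mul_left (c := 2 * k + 1) ?_ (by omega)
    refine le_trans ?_ (hasGrowth_crankGF k m)
    rw [← mul_assoc, mul_comm (2 * k + 1)]
    exact Nat.mul_le_mul_right _ h
  calc 21 * coeff m (crankGF k) ≤ ((19 - k) + (k + 2)) * coeff m (crankGF k) :=
        Nat.mul_le_mul_right _ (by omega)
    _ ≤ _ := by rw [add_mul]; omega

lemma mul_coeff_X_pow_mul_crankGF_le {n : ℕ} (hn : 436 ≤ n) (k : ℕ) :
    21 * coeff n (X ^ ((k + 1) * (k + 3)) * crankGF k) ≤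
      coeff n (X ^ ((k + 1) * (k + 2)) * rectGF k) := by
  rw [coeff_X_pow_mul', coeff_X_pow_mul']
  split_ifs with h1 h2
  · have e : n - (k + 1) * (k + 2) = n - (k + 1) * (k + 3) + (k + 1) := by
      have : (k + 1) * (k + 3) = (k + 1) * (k + 2) + (k + 1) := by ring
      omega
    rw [e]
    refine mul_coeff_crankGF_le_coeff_rectGF ?_
    rcases lt_or_ge k 19 with hk | hk
    -- For `k ≤ 18` the requirement is `n ≥ (k + 1)(k + 3) + (19 - k)(2k + 1) = -k² + 41k + 22`,
    -- largest at `k = 18`, where it equals `436`.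
    · interval_cases k <;> omega
    · simp [Nat.sub_eq_zero_of_le hk]
  · exact absurd (le_trans (Nat.mul_le_mul_left _ (by omega)) h1) h2
  · simp
  · simp

/-! ### Multisets counted by products of geometric series -/

section Families

/-- The multisets of sum `b` all of whose elements lie in `(r, r + k]`. -/
def boundedParts (r : ℕ) : ℕ → ℕ → Finset (Multiset ℕ)
  | 0, b => if b = 0 then {0} else ∅
  | k + 1, b => boundedParts r k b ∪
      if _h : r + k + 1 ≤ b then
        (boundedParts r (k + 1) (b - (r + k + 1))).image (fun s => (r + k + 1) ::ₘ s)
      else ∅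
  termination_by k b => (k, b)

/-- The multisets of `k` natural numbers of sum `b`. -/
def sizedParts : ℕ → ℕ → Finset (Multiset ℕ)
  | 0, b => if b = 0 then {0} else ∅
  | k + 1, b => (sizedParts k b).image (fun s => 0 ::ₘ s) ∪
      if _h : k + 1 ≤ b then
        (sizedParts (k + 1) (b - (k + 1))).image (fun s => s.map Nat.succ)
      else ∅
  termination_by k b => (k, b)

lemma mem_boundedParts {r k b : ℕ} {s : Multiset ℕ} :
    s ∈ boundedParts r k b ↔ (∀ x ∈ s, r < x ∧ x ≤ r + k) ∧ s.sum = b := by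
  induction k generalizing b s with
  | zero =>
    rw [boundedParts]
    have h0 : (∀ x ∈ s, r < x ∧ x ≤ r + 0) ↔ s = 0 := by
      refine ⟨fun h => Multiset.eq_zero_of_forall_notMem fun x hx => ?_, ?_⟩
      · have := h x hx
        omega
      · rintro rfl
        simp
    rw [h0]
    split_ifs with hb
    · rw [Finset.mem_singleton]
      exact ⟨fun h => ⟨h, by simp [h, hb]⟩, And.left⟩
    · simp only [Finset.notMem_empty, false_iff]
      rintro ⟨rfl, h⟩
      exact hb h.symm
  | succ k ih =>
    induction b using Nat.strong_induction_on generalizing s with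
    | _ b ihb =>
      rw [boundedParts, Finset.mem_union, ih]
      constructor
      · rintro (⟨h1, h2⟩ | h)
        · exact ⟨fun x hx => ⟨(h1 x hx).1, (h1 x hx).2.trans (by omega)⟩, h2⟩
        · split_ifs at h with hb
          · obtain ⟨t, ht, rfl⟩ := Finset.mem_image.1 h
            rw [ihb _ (by omega)] at ht
            refine ⟨fun x hx => ?_, ?_⟩
            · rcases Multiset.mem_cons.1 hx with rfl | hx
              · omega
              · exact ht.1 x hx
            · rw [Multiset.sum_cons, ht.2]
              omega
          · simp at h
      · rintro ⟨h1, h2⟩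
        by_cases hk : r + k + 1 ∈ s
        · right
          obtain ⟨t, rfl⟩ := Multiset.exists_cons_of_mem hk
          rw [Multiset.sum_cons] at h2
          rw [dif_pos (by omega), Finset.mem_image]
          refine ⟨t, (ihb _ (by omega)).2 ⟨fun x hx => h1 x (Multiset.mem_cons_of_mem hx), ?_⟩, rfl⟩
          omega
        · left
          refine ⟨fun x hx => ⟨(h1 x hx).1, ?_⟩, h2⟩
          have := (h1 x hx).2
          have : x ≠ r + k + 1 := fun h => hk (h ▸ hx)
          omega

lemma mem_sizedParts {k b : ℕ} {s : Multiset ℕ} :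
    s ∈ sizedParts k b ↔ s.card = k ∧ s.sum = b := by
  induction k generalizing b s with
  | zero =>
    rw [sizedParts, Multiset.card_eq_zero]
    split_ifs with hb
    · rw [Finset.mem_singleton]
      exact ⟨fun h => ⟨h, by simp [h, hb]⟩, And.left⟩
    · simp only [Finset.notMem_empty, false_iff]
      rintro ⟨rfl, h⟩
      exact hb h.symm
  | succ k ih =>
    induction b using Nat.strong_induction_on generalizing s with
    | _ b ihb =>
      have hsum : ∀ t : Multiset ℕ, (t.map Nat.succ).sum = t.sum + t.card := fun t => by
        induction t using Multiset.induction with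
        | empty => simp
        | cons a t ih => simp only [Multiset.map_cons, Multiset.sum_cons, Multiset.card_cons, ih]; omega
      rw [sizedParts, Finset.mem_union]
      constructor
      · rintro (h | h)
        · obtain ⟨t, ht, rfl⟩ := Finset.mem_image.1 h
          rw [ih] at ht
          simp [ht.1, ht.2]
        · split_ifs at h with hb
          · obtain ⟨t, ht, rfl⟩ := Finset.mem_image.1 h
            rw [ihb _ (by omega)] at ht
            rw [Multiset.card_map, hsum, ht.1, ht.2]
            omega
          · simp at h
      · rintro ⟨h1, h2⟩
        by_cases hk : 0 ∈ s
        · left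
          obtain ⟨t, rfl⟩ := Multiset.exists_cons_of_mem hk
          rw [Multiset.card_cons] at h1
          rw [Multiset.sum_cons, zero_add] at h2
          exact Finset.mem_image.2 ⟨t, ih.2 ⟨by omega, h2⟩, rfl⟩
        · right
          have hs : (s.map Nat.pred).map Nat.succ = s := by
            rw [Multiset.map_map]
            conv_rhs => rw [← Multiset.map_id s]
            exact Multiset.map_congr rfl fun x hx =>
              Nat.succ_pred_eq_of_ne_zero fun h => hk (h ▸ hx)
          have h3 := hsum (s.map Nat.pred)
          rw [hs, Multiset.card_map, h1, h2] at h3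
          rw [dif_pos (by omega), Finset.mem_image]
          exact ⟨s.map Nat.pred, (ihb _ (by omega)).2 ⟨by simpa using h1, by omega⟩, hs⟩

lemma card_boundedParts_succ (r k b : ℕ) : (boundedParts r (k + 1) b).card =
    (boundedParts r k b).card +
      if r + k + 1 ≤ b then (boundedParts r (k + 1) (b - (r + k + 1))).card else 0 := by
  rw [boundedParts, Finset.card_union_of_disjoint]
  · congr 1
    split_ifs
    · exact Finset.card_image_of_injective _ fun _ _ h => (Multiset.cons_inj_right _).1 h
    · rfl
  · rw [Finset.disjoint_left]
    intro s hs h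
    split_ifs at h
    · obtain ⟨t, -, rfl⟩ := Finset.mem_image.1 h
      have := ((mem_boundedParts.1 hs).1 _ (Multiset.mem_cons_self _ _)).2
      omega
    · simp at h

lemma card_sizedParts_succ (k b : ℕ) : (sizedParts (k + 1) b).card =
    (sizedParts k b).card + if k + 1 ≤ b then (sizedParts (k + 1) (b - (k + 1))).card else 0 := by
  rw [sizedParts, Finset.card_union_of_disjoint]
  · congr 1
    · exact Finset.card_image_of_injective _ fun _ _ h => (Multiset.cons_inj_right _).1 h
    · split_ifs
      · exact Finset.card_image_of_injective _ (Multiset.map_injective Nat.succ_injective)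
      · rfl
  · rw [Finset.disjoint_left]
    intro s hs h
    split_ifs at h
    · obtain ⟨t, -, rfl⟩ := Finset.mem_image.1 h
      obtain ⟨u, -, hu⟩ := Finset.mem_image.1 hs
      have h0 : 0 ∈ t.map Nat.succ := hu ▸ Multiset.mem_cons_self 0 u
      simp at h0
    · simp at h

/-- A power series with the coefficient recursion of `geom d * G` equals `geom d * G`. -/
lemma eq_geom_mul {d : ℕ} (hd : 0 < d) {F G : ℕ⟦X⟧}
    (h : ∀ n, coeff n F = coeff n G + if d ≤ n then coeff (n - d) F else 0) : F = geom d * G := by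
  ext n
  induction n using Nat.strong_induction_on with
  | _ n ih =>
    rw [h, coeff_geom_mul hd]
    split_ifs with hn
    · rw [ih _ (by omega)]
    · rfl

/-- The generating function of `boundedParts r k`. -/
noncomputable def boundedGF (r k : ℕ) : ℕ⟦X⟧ := PowerSeries.mk fun b => (boundedParts r k b).card

/-- The generating function of `sizedParts k`. -/
noncomputable def sizedGF (k : ℕ) : ℕ⟦X⟧ := PowerSeries.mk fun b => (sizedParts k b).card

lemma boundedGF_zero (r : ℕ) : boundedGF r 0 = 1 := by
  ext b
  rw [boundedGF, coeff_mk, boundedParts, coeff_one]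
  split_ifs <;> rfl

lemma sizedGF_zero : sizedGF 0 = 1 := by
  ext b
  rw [sizedGF, coeff_mk, sizedParts, coeff_one]
  split_ifs <;> rfl

lemma boundedGF_succ (r k : ℕ) : boundedGF r (k + 1) = geom (r + k + 1) * boundedGF r k :=
  eq_geom_mul (by omega) fun b => by
    simp only [boundedGF, coeff_mk]
    exact card_boundedParts_succ r k b

/-- Either some entry is zero and is removed, or every entry drops by one. This recursion gives the
product formula without conjugating partitions. -/
lemma sizedGF_succ (k : ℕ) : sizedGF (k + 1) = geom (k + 1) * sizedGF k :=
  eq_geom_mul (by omega) fun b => by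
    simp only [sizedGF, coeff_mk]
    exact card_sizedParts_succ k b

lemma crankGF_eq (k : ℕ) : crankGF k = boundedGF 1 k * sizedGF (k + 1) := by
  induction k with
  | zero => rw [crankGF, boundedGF_zero, sizedGF_succ, sizedGF_zero, one_mul, mul_one]
  | succ k ih =>
    rw [crankGF, boundedGF_succ, sizedGF_succ (k + 1), ih, show 1 + k + 1 = k + 2 by ring]
    ring

lemma boundedGF_zero_succ (k : ℕ) : boundedGF 0 (k + 1) = geom 1 * boundedGF 1 k := by
  induction k with
  | zero => rw [boundedGF_succ, boundedGF_zero, boundedGF_zero]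
  | succ k ih =>
    rw [boundedGF_succ, ih, boundedGF_succ, show 0 + (k + 1) + 1 = 1 + k + 1 by ring]
    ring

lemma rectGF_eq (k : ℕ) : rectGF k = boundedGF 0 (k + 2) * sizedGF (k + 1) := by
  rw [rectGF, boundedGF_succ, boundedGF_zero_succ, crankGF_eq, zero_add]
  ring

/-- Pairs of a multiset with elements in `(r, r + j]` and a multiset of size `l`, of total
sum `m`. -/
def partPairs (r j l m : ℕ) : Finset (Multiset ℕ × Multiset ℕ) :=
  (Finset.HasAntidiagonal.antidiagonal m).biUnion fun p => boundedParts r j p.1 ×ˢ sizedParts l p.2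

lemma mem_partPairs {r j l m : ℕ} {p : Multiset ℕ × Multiset ℕ} :
    p ∈ partPairs r j l m ↔
      (∀ x ∈ p.1, r < x ∧ x ≤ r + j) ∧ p.2.card = l ∧ p.1.sum + p.2.sum = m := by
  simp only [partPairs, Finset.mem_biUnion, Finset.HasAntidiagonal.mem_antidiagonal, Finset.mem_product,
    mem_boundedParts, mem_sizedParts, Prod.exists]
  constructor
  · rintro ⟨a, b, rfl, ⟨h1, rfl⟩, h2, rfl⟩
    exact ⟨h1, h2, rfl⟩
  · rintro ⟨h1, h2, h3⟩
    exact ⟨_, _, h3, ⟨h1, rfl⟩, h2, rfl⟩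

lemma card_partPairs (r j l m : ℕ) :
    (partPairs r j l m).card = coeff m (boundedGF r j * sizedGF l) := by
  rw [partPairs, Finset.card_biUnion, coeff_mul]
  · simp [boundedGF, sizedGF]
  · rintro ⟨a, b⟩ - ⟨c, d⟩ - h
    rw [Function.onFun, Finset.disjoint_left]
    rintro ⟨s, t⟩ h1 h2
    simp only [Finset.mem_product, mem_boundedParts, mem_sizedParts] at h1 h2
    exact h (by rw [← h1.1.2, ← h1.2.2, ← h2.1.2, ← h2.2.2])

end Families

lemma sum_map_add (t : Multiset ℕ) (c : ℕ) : (t.map (· + c)).sum = t.sum + t.card * c := by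
  simp [Multiset.sum_map_add]

/-! ### Decomposition of partitions with crank zero -/

section Crank

/-- The partition with `k + 1` ones, further small parts `p.1`, and large parts given by `p.2`. -/
def crankParts (k : ℕ) (p : Multiset ℕ × Multiset ℕ) : Multiset ℕ :=
  Multiset.replicate (k + 1) 1 + p.1 + p.2.map (· + (k + 2))

lemma exists_crankParts_eq {n : ℕ} (hn : n ≠ 0) (π : n.Partition) (hπ : crank π = 0) :
    ∃ k < n, (k + 1) * (k + 3) ≤ n ∧
      ∃ p ∈ partPairs 1 k (k + 1) (n - (k + 1) * (k + 3)), crankParts k p = π.parts := by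
  classical
  -- Without ones the crank is the largest part, which is positive since `n ≠ 0`.
  have hcount : π.parts.count 1 ≠ 0 := by
    intro h0
    rw [crank, if_pos h0] at hπ
    have hsup : π.parts.sup = 0 := by exact_mod_cast hπ
    have h : π.parts = 0 := Multiset.eq_zero_of_forall_notMem fun x hx => by
      have h1 := Multiset.le_sup hx
      have h2 := π.parts_pos hx
      rw [hsup] at h1
      exact absurd h2 (by simpa using h1)
    have := π.parts_sum
    rw [h] at this
    exact hn this.symm
  obtain ⟨k, hk⟩ := Nat.exists_eq_succ_of_ne_zero hcount
  rw [crank, if_neg hcount, hk, sub_eq_zero] at hπ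
  have hcard : (π.parts.filter fun i => k.succ < i).card = k + 1 := by exact_mod_cast hπ
  set L := π.parts.filter fun i => k.succ < i with hL
  set R := π.parts.filter fun i => ¬ k.succ < i with hR
  have hLR : L + R = π.parts := Multiset.filter_add_not _ _
  set S := R.filter fun i => ¬ i = 1 with hS
  have hone : R.filter (fun i => i = 1) = Multiset.replicate (k + 1) 1 := by
    rw [Multiset.filter_eq', hR, Multiset.count_filter_of_pos (by omega), hk]
  have hRS : Multiset.replicate (k + 1) 1 + S = R := by
    rw [← hone]
    exact Multiset.filter_add_not _ _
  have hLmap : (L.map (· - (k + 2))).map (· + (k + 2)) = L := by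
    rw [Multiset.map_map]
    conv_rhs => rw [← Multiset.map_id L]
    refine Multiset.map_congr rfl fun x hx => ?_
    have := (Multiset.mem_filter.1 hx).2
    simp only [Function.comp, id]
    omega
  have hparts : crankParts k (S, L.map (· - (k + 2))) = π.parts := by
    rw [crankParts, hLmap, hRS, add_comm, hLR]
  have hsum := congrArg Multiset.sum hparts
  rw [crankParts, Multiset.sum_add, Multiset.sum_add, sum_map_add, Multiset.sum_replicate,
    Multiset.card_map, hcard, π.parts_sum, smul_eq_mul] at hsum
  simp only at hsum
  have hle : k + 1 ≤ (k + 1) * (k + 2) := Nat.le_mul_of_pos_right _ (by omega)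
  have e : (k + 1) * (k + 3) = (k + 1) * 1 + (k + 1) * (k + 2) := by ring
  refine ⟨k, by omega, by omega, (S, L.map (· - (k + 2))), ?_, hparts⟩
  rw [mem_partPairs]
  refine ⟨fun x hx => ?_, by rw [Multiset.card_map, hcard], ?_⟩
  · obtain ⟨h1, h2⟩ := Multiset.mem_filter.1 hx
    obtain ⟨h3, h4⟩ := Multiset.mem_filter.1 h1
    have := π.parts_pos h3
    omega
  · simp only
    omega

/-- Only an upper bound is needed, so the decomposition has to cover all such partitions but need
not be shown unique. -/
lemma card_crank_zero_le {n : ℕ} (hn : n ≠ 0) :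
    Fintype.card {π : n.Partition // crank π = 0} ≤
      ∑ k ∈ Finset.range n, coeff n (X ^ ((k + 1) * (k + 3)) * crankGF k) := by
  classical
  let U : Finset (Multiset ℕ) := (Finset.range n).biUnion fun k =>
    if (k + 1) * (k + 3) ≤ n then
      (partPairs 1 k (k + 1) (n - (k + 1) * (k + 3))).image (crankParts k) else ∅
  calc Fintype.card {π : n.Partition // crank π = 0}
      = (Finset.univ : Finset {π : n.Partition // crank π = 0}).card := rfl
    _ ≤ U.card := by
        refine Finset.card_le_card_of_injOn (fun π => π.1.parts) (fun π _ => ?_) ?_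
        · obtain ⟨k, h1, h2, p, h3, h4⟩ := exists_crankParts_eq hn π.1 π.2
          refine Finset.mem_biUnion.2 ⟨k, Finset.mem_range.2 h1, ?_⟩
          rw [if_pos h2]
          exact Finset.mem_image.2 ⟨p, h3, h4⟩
        · exact fun π _ ρ _ h => Subtype.ext (Nat.Partition.ext h)
    _ ≤ _ := by
        refine Finset.card_biUnion_le.trans (Finset.sum_le_sum fun k _ => ?_)
        rw [coeff_X_pow_mul']
        split_ifs
        · rw [crankGF_eq, ← card_partPairs]
          exact Finset.card_image_le
        · simp

end Crank

/-! ### Durfee rectangles and the lower bound for the partition number -/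

section Rectangle

/-- The partition with `k + 1` parts that are at least `k + 2`, given by `p.2`, and other
parts `p.1`. -/
def rectParts (k : ℕ) (p : Multiset ℕ × Multiset ℕ) : Multiset ℕ :=
  p.1 + p.2.map (· + (k + 2))

lemma filter_lt_rectParts {k m j : ℕ} {p : Multiset ℕ × Multiset ℕ}
    (hp : p ∈ partPairs 0 (k + 2) (k + 1) m) (hj : k + 2 ≤ j) :
    (rectParts k p).filter (fun i => j < i) = (p.2.map (· + (k + 2))).filter fun i => j < i := by
  rw [rectParts, Multiset.filter_add, Multiset.filter_eq_nil.2, zero_add]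
  intro x hx h
  have := ((mem_partPairs.1 hp).1 x hx).2
  omega

/-- If `k < k'`, the second form has at least `k' + 1` parts exceeding `k + 2`, while the first has
at most `k + 1`. -/
lemma eq_of_rectParts_eq {k m k' m' : ℕ} {p q : Multiset ℕ × Multiset ℕ}
    (hp : p ∈ partPairs 0 (k + 2) (k + 1) m) (hq : q ∈ partPairs 0 (k' + 2) (k' + 1) m')
    (h : rectParts k p = rectParts k' q) : k' ≤ k := by
  by_contra! hlt
  have h1 : ((rectParts k p).filter (fun i => k + 2 < i)).card ≤ k + 1 := by
    rw [filter_lt_rectParts hp le_rfl]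
    refine (Multiset.card_le_card (Multiset.filter_le _ _)).trans ?_
    rw [Multiset.card_map, (mem_partPairs.1 hp).2.1]
  have h2 : k' + 1 ≤ ((rectParts k' q).filter (fun i => k + 2 < i)).card := by
    rw [rectParts, Multiset.filter_add, Multiset.card_add,
      (Multiset.filter_eq_self (s := q.2.map (· + (k' + 2)))).2, Multiset.card_map,
      (mem_partPairs.1 hq).2.1]
    · exact Nat.le_add_left _ _
    · intro x hx
      obtain ⟨y, -, rfl⟩ := Multiset.mem_map.1 hx
      omega
  rw [h] at h1
  omega

lemma rectParts_injOn (k m : ℕ) :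
    Set.InjOn (rectParts k) (partPairs 0 (k + 2) (k + 1) m : Set (Multiset ℕ × Multiset ℕ)) := by
  intro p hp q hq h
  have hp' := mem_partPairs.1 (Finset.mem_coe.1 hp)
  have hq' := mem_partPairs.1 (Finset.mem_coe.1 hq)
  -- A part equal to `k + 2` may come from either component. The second is still determined: it
  -- supplies all parts above `k + 2`, padded by copies of `k + 2` to its fixed size.
  have hfilter : ∀ t : Multiset ℕ, t.map (· + (k + 2)) =
      (t.map (· + (k + 2))).filter (fun i => k + 2 < i) + Multiset.replicate
        (t.card - ((t.map (· + (k + 2))).filter (fun i => k + 2 < i)).card) (k + 2) := by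
    intro t
    have h1 := Multiset.filter_add_not (fun i => k + 2 < i) (t.map (· + (k + 2)))
    have h2 := congrArg Multiset.card h1
    rw [Multiset.card_add, Multiset.card_map] at h2
    conv_lhs => rw [← h1]
    congr 1
    rw [Multiset.eq_replicate]
    refine ⟨by omega, fun x hx => ?_⟩
    obtain ⟨h3, h4⟩ := Multiset.mem_filter.1 hx
    obtain ⟨y, -, rfl⟩ := Multiset.mem_map.1 h3
    omega
  have hF := congrArg (Multiset.filter fun i => k + 2 < i) h
  rw [filter_lt_rectParts hp le_rfl, filter_lt_rectParts hq le_rfl] at hF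
  have hmap : p.2.map (· + (k + 2)) = q.2.map (· + (k + 2)) := by
    rw [hfilter p.2, hfilter q.2, hF, hp'.2.1, hq'.2.1]
  have h2 : p.2 = q.2 := Multiset.map_injective (add_left_injective (k + 2)) hmap
  rw [rectParts, rectParts, hmap] at h
  exact Prod.ext (add_right_cancel h) h2

lemma sum_rectGF_le_card (n : ℕ) :
    ∑ k ∈ Finset.range n, coeff n (X ^ ((k + 1) * (k + 2)) * rectGF k) ≤
      Fintype.card n.Partition := by
  classical
  let V : ℕ → Finset (Multiset ℕ) := fun k =>
    if (k + 1) * (k + 2) ≤ n then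
      (partPairs 0 (k + 2) (k + 1) (n - (k + 1) * (k + 2))).image (rectParts k) else ∅
  have hV : ∀ k s, s ∈ V k → (k + 1) * (k + 2) ≤ n ∧
      ∃ p ∈ partPairs 0 (k + 2) (k + 1) (n - (k + 1) * (k + 2)), rectParts k p = s := by
    intro k s hs
    simp only [V] at hs
    split_ifs at hs with h
    · exact ⟨h, Finset.mem_image.1 hs⟩
    · simp at hs
  have hcard : ∀ k, (V k).card = coeff n (X ^ ((k + 1) * (k + 2)) * rectGF k) := by
    intro k
    simp only [V]
    rw [coeff_X_pow_mul']
    split_ifs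
    · rw [rectGF_eq, ← card_partPairs, Finset.card_image_of_injOn (rectParts_injOn _ _)]
    · rfl
  have hdisj : Set.PairwiseDisjoint (Finset.range n : Set ℕ) V := by
    intro k _ k' _ hne
    rw [Function.onFun, Finset.disjoint_left]
    intro s hs hs'
    obtain ⟨-, p, hp, rfl⟩ := hV k s hs
    obtain ⟨-, q, hq, h⟩ := hV k' _ hs'
    exact hne (le_antisymm (eq_of_rectParts_eq hq hp h) (eq_of_rectParts_eq hp hq h.symm))
  have hsub : (Finset.range n).biUnion V ⊆
      (Finset.univ : Finset n.Partition).image Nat.Partition.parts := by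
    intro s hs
    obtain ⟨k, -, hk⟩ := Finset.mem_biUnion.1 hs
    obtain ⟨hle, p, hp, rfl⟩ := hV k s hk
    obtain ⟨h1, h2, h3⟩ := mem_partPairs.1 hp
    refine Finset.mem_image.2 ⟨⟨rectParts k p, fun {i} hi => ?_, ?_⟩, Finset.mem_univ _, rfl⟩
    · rcases Multiset.mem_add.1 hi with hi | hi
      · exact (h1 _ hi).1
      · obtain ⟨y, -, rfl⟩ := Multiset.mem_map.1 hi
        omega
    · rw [rectParts, Multiset.sum_add, sum_map_add, h2]
      omega
  calc _ = ∑ k ∈ Finset.range n, (V k).card := Finset.sum_congr rfl fun k _ => (hcard k).symm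
    _ = ((Finset.range n).biUnion V).card := (Finset.card_biUnion hdisj).symm
    _ ≤ _ := (Finset.card_le_card hsub).trans Finset.card_image_le

end Rectangle

/-! ### Kronecker substitution: power series as integers modulo `b ^ N` -/

section Kronecker

variable {b N : ℕ}

/-- The value at `b` of the truncation of `F` to degrees less than `N`. -/
noncomputable def truncEval (b N : ℕ) (F : ℕ⟦X⟧) : ℕ :=
  ∑ i ∈ Finset.range N, coeff i F * b ^ i

lemma truncEval_add (F G : ℕ⟦X⟧) :
    truncEval b N (F + G) = truncEval b N F + truncEval b N G := by
  simp [truncEval, add_mul, Finset.sum_add_distrib]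

lemma truncEval_X_mul (F : ℕ⟦X⟧) : truncEval b N (X * F) ≡ b * truncEval b N F [MOD b ^ N] := by
  cases N with
  | zero => simpa using Nat.modEq_one
  | succ N =>
    have h : b * truncEval b (N + 1) F = truncEval b (N + 1) (X * F) + b ^ (N + 1) * coeff N F := by
      rw [truncEval, Finset.sum_range_succ, truncEval, Finset.sum_range_succ', mul_add,
        Finset.mul_sum]
      simp only [coeff_succ_X_mul, coeff_zero_X_mul]
      rw [zero_mul, add_zero]
      congr 1
      · exact Finset.sum_congr rfl fun i _ => by ring
      · ring
    rw [h]
    exact (Nat.modEq_iff_dvd' (Nat.le_add_right _ _)).2 (by simp)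

lemma truncEval_X_pow_mul (d : ℕ) (F : ℕ⟦X⟧) :
    truncEval b N (X ^ d * F) ≡ b ^ d * truncEval b N F [MOD b ^ N] := by
  induction d with
  | zero => simpa using Nat.ModEq.refl _
  | succ d ih =>
    rw [pow_succ', mul_assoc, pow_succ', mul_assoc]
    exact (truncEval_X_mul _).trans (ih.mul_left b)

/-- The quotient is `1 + b^d + ⋯ + b^(d(N-1))`, an inverse of `1 - b^d` modulo `b^N` because `b^N`
divides `b^(dN)`. -/
lemma truncEval_geom_mul {d : ℕ} (hd : 0 < d) (hb : 1 < b) (F : ℕ⟦X⟧) :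
    truncEval b N (geom d * F) ≡
      truncEval b N F * ((b ^ (d * N) - 1) / (b ^ d - 1)) [MOD b ^ N] := by
  set Q := (b ^ (d * N) - 1) / (b ^ d - 1) with hQ
  have hpos : 0 < b := by omega
  have hmul : (b ^ d - 1) * Q = b ^ (d * N) - 1 := by
    rw [hQ, pow_mul]
    exact Nat.mul_div_cancel' (Nat.sub_one_dvd_pow_sub_one _ _)
  set g := truncEval b N (geom d * F)
  set f := truncEval b N F
  have h1 : g ≡ f + b ^ d * g [MOD b ^ N] := by
    have h := truncEval_add (b := b) (N := N) F (X ^ d * (geom d * F))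
    rw [← geom_mul hd] at h
    exact (congrArg (· % b ^ N) h).trans ((truncEval_X_pow_mul d _).add_left f)
  have h2 : ((b : ℤ) ^ d - 1) * Q = b ^ (d * N) - 1 := by
    have := congrArg (Nat.cast : ℕ → ℤ) hmul
    rw [Nat.cast_mul, Nat.cast_sub (Nat.one_le_pow _ _ hpos),
      Nat.cast_sub (Nat.one_le_pow _ _ hpos)] at this
    exact_mod_cast this
  rw [← Int.natCast_modEq_iff] at h1 ⊢
  rw [Int.modEq_iff_dvd] at h1 ⊢
  push_cast at h1 ⊢
  have h3 : (b : ℤ) ^ N ∣ b ^ (d * N) := pow_dvd_pow _ (Nat.le_mul_of_pos_left _ hd)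
  have e : (f : ℤ) * Q - g = (f + b ^ d * g - g) * Q - b ^ (d * N) * g := by
    linear_combination (-(g : ℤ)) * h2
  rw [e]
  exact dvd_sub (h1.mul_right _) (h3.mul_right _)

lemma sum_mul_pow_lt {c : ℕ → ℕ} (hc : ∀ i < N, c i < b) :
    ∑ i ∈ Finset.range N, c i * b ^ i < b ^ N := by
  induction N with
  | zero => simp
  | succ N ih =>
    rw [Finset.sum_range_succ, pow_succ']
    have h1 := ih fun i hi => hc i (by omega)
    have h2 := Nat.mul_le_mul_right (b ^ N) (Nat.succ_le_of_lt (hc N N.lt_succ_self))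
    rw [Nat.succ_mul] at h2
    omega

lemma sum_mul_pow_div_mod {c : ℕ → ℕ} (hc : ∀ i < N, c i < b) {n : ℕ} (hn : n < N) :
    (∑ i ∈ Finset.range N, c i * b ^ i) / b ^ n % b = c n := by
  induction n generalizing N c with
  | zero =>
    obtain ⟨N, rfl⟩ := Nat.exists_eq_succ_of_ne_zero (by omega : N ≠ 0)
    rw [Finset.sum_range_succ', pow_zero, Nat.div_one, mul_one, Nat.add_mod,
      (Nat.dvd_iff_mod_eq_zero).1 (Finset.dvd_sum fun i _ => ⟨c (i + 1) * b ^ i, by ring⟩),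
      zero_add, Nat.mod_mod, Nat.mod_eq_of_lt (hc 0 (by omega))]
  | succ n ih =>
    obtain ⟨N, rfl⟩ := Nat.exists_eq_succ_of_ne_zero (by omega : N ≠ 0)
    have h0 := hc 0 (by omega)
    have e : ∑ i ∈ Finset.range N, c (i + 1) * b ^ (i + 1) =
        b * ∑ i ∈ Finset.range N, c (i + 1) * b ^ i := by
      rw [Finset.mul_sum]
      exact Finset.sum_congr rfl fun i _ => by ring
    rw [Finset.sum_range_succ', pow_zero, mul_one, e, pow_succ', ← Nat.div_div_eq_div_mul,
      Nat.mul_add_div (by omega), Nat.div_eq_of_lt h0, add_zero]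
    exact ih (fun i hi => hc (i + 1) (by omega)) (by omega)

/-- Coefficients smaller than `b` are the base-`b` digits of the evaluation, so nothing carries and
the residue determines them. -/
lemma coeff_eq_of_truncEval_modEq {F : ℕ⟦X⟧} {x n : ℕ} (h : truncEval b N F ≡ x [MOD b ^ N])
    (hF : ∀ i < N, coeff i F < b) (hn : n < N) : coeff n F = x % b ^ N / b ^ n % b := by
  have hlt : truncEval b N F < b ^ N := sum_mul_pow_lt hF
  rw [← h, Nat.mod_eq_of_lt hlt, truncEval,
    sum_mul_pow_div_mod (c := fun i => coeff i F) hF hn]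

end Kronecker

/-! ### Crude coefficient bounds that exclude carries -/

section Bounds

lemma coeff_geom_mul_le {d K N : ℕ} (hd : 0 < d) {G : ℕ⟦X⟧} (hG : ∀ i < N, coeff i G ≤ K) :
    ∀ i < N, coeff i (geom d * G) ≤ N * K := by
  have key : ∀ i, i < N → coeff i (geom d * G) ≤ (i + 1) * K := by
    intro i
    induction i using add_period_induction (d := d) (hd := hd) with
    | base n hn =>
      intro h
      rw [coeff_geom_mul_of_lt hd G hn]
      exact (hG n h).trans (Nat.le_mul_of_pos_left _ n.succ_pos)
    | step n ih =>
      intro h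
      rw [coeff_geom_mul_add hd]
      have h1 := hG _ h
      have h2 := ih (by omega)
      calc _ ≤ K + (n + 1) * K := Nat.add_le_add h1 h2
        _ = (n + 1 + 1) * K := by ring
        _ ≤ _ := Nat.mul_le_mul_right _ (by omega)
  exact fun i hi => (key i hi).trans (Nat.mul_le_mul_right _ (by omega))

lemma coeff_crankGF_le (N k : ℕ) : ∀ i < N, coeff i (crankGF k) ≤ N ^ (2 * k + 1) := by
  induction k with
  | zero =>
    intro i hi
    rw [crankGF, geom, coeff_mk, mul_zero, zero_add, pow_one]
    split_ifs <;> omega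
  | succ k ih =>
    have h := coeff_geom_mul_le (d := k + 2) (by omega)
      (coeff_geom_mul_le (d := k + 2) (by omega) ih)
    intro i hi
    refine (h i hi).trans_eq ?_
    ring

lemma coeff_rectGF_le (N k : ℕ) : ∀ i < N, coeff i (rectGF k) ≤ N ^ (2 * k + 3) := by
  have h := coeff_geom_mul_le (d := k + 2) (by omega)
    (coeff_geom_mul_le one_pos (coeff_crankGF_le N k))
  intro i hi
  refine (h i hi).trans_eq ?_
  ring

lemma coeff_sum_X_pow_mul_le {F : ℕ → ℕ⟦X⟧} {K N m : ℕ} (s : ℕ → ℕ)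
    (h : ∀ k < m, ∀ i < N, coeff i (F k) ≤ K) {i : ℕ} (hi : i < N) :
    coeff i (∑ k ∈ Finset.range m, X ^ s k * F k) ≤ m * K := by
  rw [map_sum]
  refine (Finset.sum_le_card_nsmul _ _ K fun k hk => ?_).trans_eq (by simp)
  rw [coeff_X_pow_mul']
  split_ifs
  · exact h k (Finset.mem_range.1 hk) _ (by omega)
  · exact Nat.zero_le _

end Bounds

/-! ### Kernel computation for `39 ≤ n < 440` -/

section Computation

/-- The base at which generating functions are evaluated. -/
def base : ℕ := 2 ^ 400

lemma one_lt_base : 1 < base := by decide +kernel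

/-- Multiplication by `geom d`, on values at `base` modulo `base ^ 440`. -/
def geomStep (d x : ℕ) : ℕ :=
  x * ((base ^ (d * 440) - 1) / (base ^ d - 1)) % base ^ 440

/-- The value of `crankGF k` at `base` modulo `base ^ 440`. -/
def crankVal : ℕ → ℕ
  | 0 => geomStep 1 1
  | k + 1 => geomStep (k + 2) (geomStep (k + 2) (crankVal k))

/-- The value at `base` of the generating function of the partitions with crank `0`. -/
def crankTotal : ℕ :=
  ((List.range 20).map fun k => base ^ ((k + 1) * (k + 3)) * crankVal k).sum %
    base ^ 440

/-- The value at `base` of the generating function of the partitions. -/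
def rectTotal : ℕ :=
  ((List.range 20).map fun k =>
    base ^ ((k + 1) * (k + 2)) * geomStep (k + 2) (geomStep 1 (crankVal k))).sum %
      base ^ 440

lemma truncEval_geomStep {d x : ℕ} (hd : 0 < d) {F : ℕ⟦X⟧}
    (h : truncEval base 440 F ≡ x [MOD base ^ 440]) :
    truncEval base 440 (geom d * F) ≡ geomStep d x [MOD base ^ 440] :=
  (truncEval_geom_mul hd one_lt_base F).trans
    ((h.mul_right _).trans (Nat.mod_modEq _ _).symm)

lemma truncEval_crankGF (k : ℕ) :
    truncEval base 440 (crankGF k) ≡ crankVal k [MOD base ^ 440] := by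
  induction k with
  | zero =>
    have h : truncEval base 440 1 ≡ 1 [MOD base ^ 440] := by
      have : truncEval base 440 1 = 1 := by
        rw [truncEval, Finset.sum_eq_single 0]
        · rw [coeff_zero_one, pow_zero, one_mul]
        · intro i _ hi
          rw [coeff_one, if_neg hi, zero_mul]
        · intro h
          exact absurd (Finset.mem_range.2 (by norm_num)) h
      rw [this]
    rw [crankGF, crankVal, ← mul_one (geom 1)]
    exact truncEval_geomStep one_pos h
  | succ k ih =>
    exact truncEval_geomStep (by omega) (truncEval_geomStep (by omega) ih)

lemma truncEval_rectGF (k : ℕ) : truncEval base 440 (rectGF k) ≡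
    geomStep (k + 2) (geomStep 1 (crankVal k)) [MOD base ^ 440] :=
  truncEval_geomStep (by omega) (truncEval_geomStep one_pos (truncEval_crankGF k))

lemma truncEval_sum_X_pow_mul {F : ℕ → ℕ⟦X⟧} {v : ℕ → ℕ} {b N : ℕ} (s : ℕ → ℕ) (m : ℕ)
    (h : ∀ k, truncEval b N (F k) ≡ v k [MOD b ^ N]) :
    truncEval b N (∑ k ∈ Finset.range m, X ^ s k * F k) ≡
      ((List.range m).map fun k => b ^ s k * v k).sum [MOD b ^ N] := by
  induction m with
  | zero => simp [truncEval, Nat.ModEq.refl]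
  | succ m ih =>
    rw [Finset.sum_range_succ, truncEval_add, List.range_succ, List.map_append, List.sum_append,
      List.map_singleton, List.sum_singleton]
    exact ih.add ((truncEval_X_pow_mul _ _).trans ((h m).mul_left _))

lemma crankTotal_le_rectTotal :
    (List.range 401).all (fun i => Nat.ble (21 * (crankTotal / base ^ (39 + i) % base))
      (rectTotal / base ^ (39 + i) % base)) = true := by
  decide +kernel

/-- Each sum has `20` terms with coefficients at most `440 ^ (2 * 19 + 3)`, so every digit fits
below `base`. -/
lemma twenty_mul_pow_lt : 20 * 440 ^ 41 < base := by decide +kernel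

lemma sum_crankGF_le_sum_rectGF {n : ℕ} (h1 : 39 ≤ n) (h2 : n < 440) :
    21 * coeff n (∑ k ∈ Finset.range 20, X ^ ((k + 1) * (k + 3)) * crankGF k) ≤
      coeff n (∑ k ∈ Finset.range 20, X ^ ((k + 1) * (k + 2)) * rectGF k) := by
  have hM := coeff_eq_of_truncEval_modEq (truncEval_sum_X_pow_mul
    (fun k => (k + 1) * (k + 3)) 20 truncEval_crankGF)
    (fun i hi => (coeff_sum_X_pow_mul_le (K := 440 ^ 41) _ (fun k hk j hj =>
      (coeff_crankGF_le 440 k j hj).trans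
        (Nat.pow_le_pow_right (by norm_num) (by omega : _ ≤ 41))) hi).trans_lt twenty_mul_pow_lt) h2
  have hP := coeff_eq_of_truncEval_modEq (truncEval_sum_X_pow_mul
    (fun k => (k + 1) * (k + 2)) 20 truncEval_rectGF)
    (fun i hi => (coeff_sum_X_pow_mul_le (K := 440 ^ 41) _ (fun k hk j hj =>
      (coeff_rectGF_le 440 k j hj).trans
        (Nat.pow_le_pow_right (by norm_num) (by omega : _ ≤ 41))) hi).trans_lt twenty_mul_pow_lt) h2
  have h := List.all_eq_true.1 crankTotal_le_rectTotal (n - 39) (List.mem_range.2 (by omega))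
  rw [show 39 + (n - 39) = n by omega] at h
  replace h := Nat.le_of_ble_eq_true h
  rw [crankTotal, rectTotal] at h
  rw [hM, hP]
  exact h

end Computation

/-! ### Combining the two ranges of `n` -/

lemma mul_sum_coeff_crankGF_le {n : ℕ} (hn : 39 ≤ n) :
    21 * ∑ k ∈ Finset.range n, coeff n (X ^ ((k + 1) * (k + 3)) * crankGF k) ≤
      ∑ k ∈ Finset.range n, coeff n (X ^ ((k + 1) * (k + 2)) * rectGF k) := by
  rcases lt_or_ge n 440 with h | h
  -- Terms with `k ≥ 20` vanish, since their exponents are at least `21 * 22 = 462 > n`.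
  · have h20 : Finset.range 20 ⊆ Finset.range n := Finset.range_mono (by omega)
    rw [← Finset.sum_subset h20, ← Finset.sum_subset h20, ← map_sum, ← map_sum]
    · exact sum_crankGF_le_sum_rectGF hn h
    all_goals
      intro k _ hk
      rw [Finset.mem_range, not_lt] at hk
      rw [coeff_X_pow_mul', if_neg]
      nlinarith
  · rw [Finset.mul_sum]
    exact Finset.sum_le_sum fun k _ => mul_coeff_X_pow_mul_crankGF_le (by omega) k

end PartitionCrank

theorem mainTheorem6 (n : ℕ) (hn : 39 ≤ n) :
    (Fintype.card n.Partition : ℤ) ≥ 21 * PartitionCrank.M 0 n := by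
  have h1 := PartitionCrank.card_crank_zero_le (n := n) (by omega)
  have h2 := PartitionCrank.mul_sum_coeff_crankGF_le hn
  have h3 := PartitionCrank.sum_rectGF_le_card n
  rw [PartitionCrank.M, if_neg (by omega)]
  exact_mod_cast ((Nat.mul_le_mul_left 21 h1).trans h2).trans h3
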